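/- All maps are continuous, paracompact spaces are Hausdorff, and multivalued mappings have non-empty values. For a CW-complex $L$ and a space $Z$, $\text{e-dim}\, Z\le [L]$ means that every map from a closed subspace of $Z$ to $L$ extends to $Z$; $[L]\le [K]$ means that every paracompact space $Z$ with $\text{e-dim}\, Z\le [L]$ satisfies $\text{e-dim}\, Z\le [K]$. A pair of spaces $V\subset U$ is $[L]$-connected if for every paracompact space $Z$ with $\text{e-dim}\, Z\le[L]$ and every closed $B\subset Z$, every map $B\to V$ extends to a map $Z\to U$. A pair $K\subset K'$ of subspaces of a space $Y$ is $UV^{[L]}$-connected in $Y$ if every open neighbourhood $U$ of $K'$ contains an open neighbourhood $V$ of $K$ such that the pair $V\subset U$ is $[L]$-connected. Let $X$ and $Y$ be topological spaces. A $UV^{[L]}$-connected $m$-filtration of a multivalued mapping $F\colon X\to Y$ is a sequence of multivalued mappings $F_0,\dots,F_m\colon X\to Y$ with $F_0(x)\subset\dots\subset F_m(x)\subset F(x)$ for all $x\in X$, such that each $F_k$ is upper semicontinuous (that is, $\{x : F_k(x)\subset W\}$ is open for every open $W\subset Y$) and for all $x\in X$ and $i<m$ the pair $F_i(x)\subset F_{i+1}(x)$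 is $UV^{[L]}$-connected in $Y$. For $A\subset X$ and a multivalued mapping $G\colon X\to Y$, an open set $U\subset X\times Y$ is a $G$-stable neighbourhood of the graph $\Gamma_{G|_A}$ if for every $x\in A$ there are an open neighbourhood $O_x$ of $x$ in $X$ and an open set $V_x\subset Y$ such that $\Gamma_{G|_{O_x}}\subset O_x\times V_x\subset U$; here $\Gamma_G=\{(x,y): y\in G(x)\}$. **Theorem.** Let $L$ be a CW-complex and $n\ge 0$ an integer such that $[L]\le [S^n]$. Let $X$ be a paracompact space with $\text{e-dim}\, X\le [L]$, let $Y$ be a topological space, and let $F\colon X\to Y$ be a multivalued mapping. (1) If $F$ admits a $UV^{[L]}$-connected $n$-filtration, then every $F$-stable neighbourhood of the graph $\Gamma_F$ contains the graph of a continuous single-valued mapping $X\to Y$. (2) Let $A\subset X$ be a closed subspace. If $F$ admits a $UV^{[L]}$-connected $(n+1)$-filtration $F_0\subset F_1\subset\dots\subset F_{n+1}$, then for every $F$-stable neighbourhood $U$ of $\Gamma_F$ there exists an $F_0$-stable neighbourhood $V$ of $\Gamma_{F_0|_A}$ such that every continuous single-valued mapping $g\colon A\to Y$ with $\Gamma_g\subset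 V$ extends to a continuous single-valued mapping $f\colon X\to Y$ with $\Gamma_f\subset U$. -/

import Mathlib

open Set Topology

universe u v w

namespace ExtDim

/-- `e-dim X ≤ [L]`: every continuous map from a closed subspace of `X` to `L`
extends continuously to the whole of `X`. -/
def EDimLE (X : Type u) [TopologicalSpace X] (L : Type w) [TopologicalSpace L] : Prop :=
  ∀ A : Set X, IsClosed A → ∀ f : C(A, L), ∃ g : C(X, L), ∀ a : A, g a = f a

/-- `[L] ≤ [K]`: every paracompact (Hausdorff) space `Z` with `e-dim Z ≤ [L]` satisfies
`e-dim Z ≤ [K]`. The universe `u` is that of the spaces `Z`. -/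
def ExtTypeLE.{a, b, c} (L : Type b) [TopologicalSpace L] (K : Type c) [TopologicalSpace K] :
    Prop :=
  ∀ (Z : Type a) [TopologicalSpace Z] [T2Space Z] [ParacompactSpace Z],
    EDimLE Z L → EDimLE Z K

/-- The `n`-dimensional sphere, as the unit sphere of Euclidean `(n + 1)`-space. -/
abbrev Sph (n : ℕ) : Type := Metric.sphere (0 : EuclideanSpace ℝ (Fin (n + 1))) 1

/-- The pair `V ⊆ U` of subspaces of `Y` is `[L]`-connected: for every paracompact (Hausdorff)
space `Z` with `e-dim Z ≤ [L]` and every closed `A ⊆ Z`, each continuous map of `A` into `V`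
extends to a continuous map of `Z` into `U`. -/
def LConnectedPair.{a, b, c} (L : Type b) [TopologicalSpace L] {Y : Type c} [TopologicalSpace Y]
    (V U : Set Y) : Prop :=
  V ⊆ U ∧
  ∀ (Z : Type a) [TopologicalSpace Z] [T2Space Z] [ParacompactSpace Z], EDimLE Z L →
    ∀ A : Set Z, IsClosed A → ∀ f : C(A, Y), (∀ a, f a ∈ V) →
      ∃ g : C(Z, Y), (∀ z, g z ∈ U) ∧ ∀ a : A, g a = f a

/-- The pair `K ⊆ K'` of subspaces of `Y` is `UV^[L]`-connected in `Y`: every open neighbourhood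
`U` of `K'` contains an open neighbourhood `V` of `K` such that the pair `V ⊆ U` is
`[L]`-connected. -/
def UVConnectedPair.{a, b, c} (L : Type b) [TopologicalSpace L] {Y : Type c} [TopologicalSpace Y]
    (K K' : Set Y) : Prop :=
  K ⊆ K' ∧
  ∀ U : Set Y, IsOpen U → K' ⊆ U →
    ∃ V : Set Y, IsOpen V ∧ K ⊆ V ∧ LConnectedPair.{a, b, c} L V U

/-- `Φ 0 ⊆ Φ 1 ⊆ ⋯ ⊆ Φ n ⊆ F` is a `UV^[L]`-connected `n`-filtration of the multivalued mapping
`F` from `X` to `Y`. Multivalued mappings have non-empty values, and `UpperHemicontinuous` is the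
usual upper semicontinuity: `{x | Φ k x ⊆ W}` is open for every open `W ⊆ Y`. -/
structure IsUVFiltration {X : Type u} [TopologicalSpace X] {Y : Type v} [TopologicalSpace Y]
    (L : Type w) [TopologicalSpace L] (n : ℕ) (F : X → Set Y) (Φ : Fin (n + 1) → X → Set Y) :
    Prop where
  nonempty : ∀ k x, (Φ k x).Nonempty
  mono : ∀ x, Monotone fun k => Φ k x
  subset : ∀ k x, Φ k x ⊆ F x
  usc : ∀ k, UpperHemicontinuous (Φ k)
  uvConnected : ∀ (i : Fin n) (x : X),
    UVConnectedPair.{u, w, v} L (Φ i.castSucc x) (Φ i.succ x)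

/-- `U` is `F`-stable with respect to `x`: there are an open neighbourhood `O` of `x` and an open
set `V ⊆ Y` such that `Γ_{F|O} ⊆ O × V ⊆ U`. -/
def IsStableAt {X : Type u} [TopologicalSpace X] {Y : Type v} [TopologicalSpace Y]
    (F : X → Set Y) (U : Set (X × Y)) (x : X) : Prop :=
  ∃ (O : Set X) (V : Set Y), IsOpen O ∧ x ∈ O ∧ IsOpen V ∧
    (∀ x' ∈ O, F x' ⊆ V) ∧ O ×ˢ V ⊆ U

/-- `U` is an `F`-stable (open) neighbourhood of the graph of `F|A`: `U` is open in `X × Y` and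
`F`-stable with respect to every point of `A`; in particular it contains the graph of `F|A`. -/
def IsStableNhdOver {X : Type u} [TopologicalSpace X] {Y : Type v} [TopologicalSpace Y]
    (F : X → Set Y) (A : Set X) (U : Set (X × Y)) : Prop :=
  IsOpen U ∧ ∀ x ∈ A, IsStableAt F U x

end ExtDim

/-! Extendability of maps into `S^n` bounds covering dimension: every open cover of `X` has a
locally finite closed refinement in which no `n + 2` members meet. The filtration, read from the top
down, turns `U` into a chain of stable neighbourhoods such that a partial map with graph in one of
them extends, over any small enough closed set, with graph in the next
(`exists_isStableNhdOver_locallyExtends`). A section is then built by decreasing multiplicity of the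
closed cover. No point has multiplicity `n + 2`; passing from multiplicity at least `j + 1` to at
least `j` costs one link, because distinct `j`-fold intersections overlap only where the map is
already defined. So `n + 1` links suffice. In (2) the filtration supplies them all; in (1) it
supplies `n`, and locally constant choices supply the first. -/

namespace ExtDim

/-! ### Covering dimension from extension of maps into spheres -/

/-- An open cover of a closed set by `n + 2` sets can be shrunk to an open cover with empty
total intersection, when the ambient normal space has `e-dim ≤ [S^n]`. -/
theorem EDimLE.exists_shrinking_iInter_eq_empty {X : Type u} [TopologicalSpace X] [NormalSpace X]
    {n : ℕ} (hX : EDimLE X (Sph n)) {C : Set X} (hC : IsClosed C) {U : Fin (n + 2) → Set X}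
    (hU : ∀ i, IsOpen (U i)) (hCU : C ⊆ ⋃ i, U i) :
    ∃ W : Fin (n + 2) → Set X, (∀ i, IsOpen (W i)) ∧ (∀ i, W i ⊆ U i) ∧ C ⊆ (⋃ i, W i) ∧
      ⋂ i, W i = ∅ := by
  obtain ⟨K, hCK, hKc, hKU⟩ :=
    exists_subset_iUnion_closed_subset hC hU (fun _ _ => toFinite _) hCU
  have hφ (i) : ∃ φ : C(X, ℝ), EqOn φ 0 (U i)ᶜ ∧ EqOn φ 1 (K i) ∧ ∀ x, φ x ∈ Icc (0 : ℝ) 1 :=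
    exists_continuous_zero_one_of_isClosed (hU i).isClosed_compl (hKc i)
      (disjoint_compl_left_iff_subset.2 (hKU i))
  choose φ hφ0 hφ1 hφI using hφ
  -- `v x = 0` exactly when all `φ i x` agree. On `B` one of them is 0 and another is 1, so `v` can
  -- be normalised to a map into the sphere.
  let v : X → EuclideanSpace ℝ (Fin (n + 1)) := fun x =>
    WithLp.toLp 2 fun i => φ i.castSucc x - φ (Fin.last _) x
  have hv : Continuous v := by
    refine (PiLp.continuous_toLp 2 _).comp (continuous_pi fun i => ?_)
    fun_prop
  let B : Set X := C ∩ ⋃ i, {x | φ i x = 0}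
  have hB : IsClosed B :=
    hC.inter (isClosed_iUnion_of_finite fun i => isClosed_eq (φ i).continuous continuous_const)
  have hpos (x) (hx : x ∈ C) : ∃ j, φ j x = 1 := by
    obtain ⟨j, hj⟩ := mem_iUnion.1 (hCK hx)
    exact ⟨j, hφ1 j hj⟩
  have hv0 (x) (hx : x ∈ B) : v x ≠ 0 := by
    intro h0
    obtain ⟨j, hj⟩ := hpos x hx.1
    obtain ⟨i, hi⟩ := mem_iUnion.1 hx.2
    have key (k : Fin (n + 2)) : φ k x = φ (Fin.last _) x := by
      refine Fin.lastCases rfl (fun k => ?_) k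
      have := congrArg (fun z : EuclideanSpace ℝ (Fin (n + 1)) => z k) h0
      exact sub_eq_zero.1 this
    have hi : φ i x = 0 := hi
    linarith [key i, key j]
  let f : C(B, Sph n) :=
    ⟨fun x => ⟨‖v x‖⁻¹ • v x, by
      rw [mem_sphere_zero_iff_norm, norm_smul, norm_inv, norm_norm,
        inv_mul_cancel₀ (norm_ne_zero_iff.2 (hv0 x x.2))]⟩, by
      refine Continuous.subtype_mk ?_ _
      have hc : Continuous fun x : B => v x := hv.comp continuous_subtype_val
      exact (hc.norm.inv₀ fun x => norm_ne_zero_iff.2 (hv0 x x.2)).smul hc⟩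
  obtain ⟨q, hq⟩ := hX B hB f
  -- The appended zero restores the symmetry between indices: on `B`, differences of the `w x i` are
  -- positive multiples of those of the `φ i x`.
  let w : X → Fin (n + 2) → ℝ := fun x => Fin.snoc (α := fun _ => ℝ) (fun i => (q x).1 i) 0
  have hwl (x) : w x (Fin.last _) = 0 := Fin.snoc_last (α := fun _ => ℝ) _ _
  have hwc (x) (i : Fin (n + 1)) : w x i.castSucc = (q x).1 i :=
    Fin.snoc_castSucc (α := fun _ => ℝ) _ _ _
  have hw (i) : Continuous fun x => w x i := by
    refine Fin.lastCases ?_ (fun i => ?_) i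
    · simpa only [hwl] using continuous_const
    · simp only [hwc]
      have : Continuous fun x => (q x).1 := continuous_subtype_val.comp q.continuous
      fun_prop
  have hwB (x) (hx : x ∈ B) (i) : w x i = ‖v x‖⁻¹ * (φ i x - φ (Fin.last _) x) := by
    refine Fin.lastCases ?_ (fun i => ?_) i
    · simp [hwl]
    · rw [hwc, hq ⟨x, hx⟩]
      rfl
  -- Keep the indices where `w x` is nearly maximal. A maximal index `i` has `x ∈ U i`: otherwise `φ
  -- i x = 0`, so `x ∈ B`, and an index with `φ j x = 1` does better. A point in every set has all
  -- sphere coordinates below `1 / (n + 1)` in absolute value, too small for norm 1.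
  refine ⟨fun i => U i ∩ ⋂ j, {x | w x j - w x i < 1 / (n + 1)}, fun i => ?_,
    fun i => inter_subset_left, fun x hx => ?_, ?_⟩
  · exact (hU i).inter (isOpen_iInter_of_finite fun j =>
      isOpen_lt ((hw j).sub (hw i)) continuous_const)
  · obtain ⟨i, hi⟩ := Finite.exists_max (w x)
    refine mem_iUnion.2 ⟨i, ?_, mem_iInter.2 fun j => ?_⟩
    · by_contra hxi
      have h0 : φ i x = 0 := hφ0 i hxi
      have hxB : x ∈ B := ⟨hx, mem_iUnion.2 ⟨i, h0⟩⟩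
      obtain ⟨j, hj⟩ := hpos x hx
      have hle := hi j
      rw [hwB x hxB, hwB x hxB] at hle
      have := le_of_mul_le_mul_left hle (inv_pos.2 (norm_pos_iff.2 (hv0 x hxB)))
      linarith
    · have h1 : (0 : ℝ) < 1 / (n + 1) := by positivity
      have := hi j
      rw [mem_ofPred_eq]
      linarith
  · refine eq_empty_of_forall_notMem fun x hx => ?_
    have hlt (i j) : w x j - w x i < 1 / (n + 1) := mem_iInter.1 (mem_iInter.1 hx i).2 j
    have h1 : ‖(q x).1‖ = 1 := mem_sphere_zero_iff_norm.1 (q x).2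
    have h2 : ∑ i, ‖(q x).1 i‖ ^ 2 = 1 := by
      rw [← EuclideanSpace.norm_sq_eq, h1, one_pow]
    have h3 : ∑ i : Fin (n + 1), ‖(q x).1 i‖ ^ 2 < ∑ _i : Fin (n + 1), (1 / ((n : ℝ) + 1)) ^ 2 := by
      refine Finset.sum_lt_sum_of_nonempty Finset.univ_nonempty fun i _ => ?_
      refine pow_lt_pow_left₀ ?_ (norm_nonneg _) two_ne_zero
      rw [Real.norm_eq_abs, abs_lt, ← hwc]
      have ha := hlt i.castSucc (Fin.last _)
      have hb := hlt (Fin.last _) i.castSucc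
      rw [hwl] at ha hb
      constructor <;> linarith
    rw [h2, Finset.sum_const, Finset.card_univ, Fintype.card_fin, nsmul_eq_mul] at h3
    have h4 : ((n + 1 : ℕ) : ℝ) * (1 / ((n : ℝ) + 1)) ^ 2 = 1 / ((n : ℝ) + 1) := by
      push_cast
      field_simp
    rw [h4, lt_div_iff₀ (by positivity)] at h3
    have : (0 : ℝ) ≤ n := n.cast_nonneg
    linarith

/-- The intersections of finitely many members of a locally finite family form a locally finite
family. -/
theorem locallyFinite_biInter_finset {X : Type u} [TopologicalSpace X] {ι : Type v}
    {D : ι → Set X} (hD : LocallyFinite D) :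
    LocallyFinite fun T : Finset ι => ⋂ s ∈ T, D s := by
  intro x
  obtain ⟨N, hN, hfin⟩ := hD x
  refine ⟨N, hN, (hfin.powerset.preimage Finset.coe_injective.injOn).subset fun T hT s hs => ?_⟩
  obtain ⟨y, hy, hyN⟩ := hT
  exact ⟨y, mem_iInter₂.1 hy s hs, hyN⟩

/-- A variant of `EDimLE.exists_shrinking_iInter_eq_empty` for `n + 2` members of a larger open
cover; only points of the intersection of these members are removed. -/
theorem EDimLE.exists_shrinking_biInter_eq_empty {X : Type u} [TopologicalSpace X] [NormalSpace X]
    {n : ℕ} (hX : EDimLE X (Sph n)) {ι : Type v} {U : ι → Set X} (hU : ∀ i, IsOpen (U i))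
    (hcov : ⋃ i, U i = univ) {T : Finset ι} (hT : T.card = n + 2) {I : Set X} (hI : IsClosed I)
    (hUI : ⋂ s ∈ T, U s ⊆ I) :
    ∃ W : ι → Set X, (∀ i, IsOpen (W i)) ∧ (∀ i, W i ⊆ U i) ∧ (∀ i, U i \ W i ⊆ I) ∧
      ⋃ i, W i = univ ∧ ⋂ s ∈ T, W s = ∅ := by
  classical
  let e : T ≃ Fin (n + 2) := T.equivFinOfCardEq hT
  obtain ⟨V, hVo, hVU, hV, hV0⟩ := hX.exists_shrinking_iInter_eq_empty
    (C := (⋃ s ∈ {s | s ∉ T}, U s)ᶜ) (U := fun i => U (e.symm i))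
    (isOpen_biUnion fun s _ => hU s).isClosed_compl (fun i => hU _) (by
      intro x hx
      obtain ⟨s, hs⟩ := mem_iUnion.1 (hcov.symm ▸ mem_univ x : x ∈ ⋃ i, U i)
      have hsT : s ∈ T := by
        by_contra h
        exact hx (mem_biUnion (show s ∈ {s | s ∉ T} from h) hs)
      exact mem_iUnion.2 ⟨e ⟨s, hsT⟩, by simpa using hs⟩)
  -- Retaining `U s` off `I` confines the loss to `I`, and creates no common points since `I`
  -- contains the whole intersection.
  refine ⟨fun s => if h : s ∈ T then U s \ I ∪ V (e ⟨s, h⟩) else U s, fun s => ?_, fun s => ?_,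
    fun s => ?_, ?_, ?_⟩
  · dsimp only
    split_ifs
    exacts [((hU s).sdiff hI).union (hVo _), hU s]
  · dsimp only
    split_ifs with h
    · refine union_subset sdiff_subset ?_
      simpa using hVU (e ⟨s, h⟩)
    · rfl
  · dsimp only
    split_ifs with h
    · rintro x ⟨hx, hx'⟩
      by_contra hxI
      exact hx' (Or.inl ⟨hx, hxI⟩)
    · simp
  · refine eq_univ_of_forall fun x => ?_
    by_cases hx : x ∈ ⋃ s ∈ {s | s ∉ T}, U s
    · obtain ⟨s, hs, hxs⟩ := mem_iUnion₂.1 hx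
      refine mem_iUnion.2 ⟨s, ?_⟩
      rwa [dif_neg hs]
    · obtain ⟨i, hi⟩ := mem_iUnion.1 (hV hx)
      refine mem_iUnion.2 ⟨e.symm i, ?_⟩
      rw [dif_pos (e.symm i).2]
      right
      simpa using hi
  · refine eq_empty_of_forall_notMem fun x hx => ?_
    have hx' (s) (hs : s ∈ T) : x ∈ U s \ I ∪ V (e ⟨s, hs⟩) := by
      have := mem_iInter₂.1 hx s hs
      simpa only [dif_pos hs] using this
    have hxI : x ∈ I := hUI <| mem_iInter₂.2 fun s hs => by
      rcases hx' s hs with h | h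
      · exact h.1
      · simpa using hVU _ h
    have : x ∈ ⋂ i, V i := mem_iInter.2 fun i => by
      rcases hx' (e.symm i) (e.symm i).2 with h | h
      · exact (h.2 hxI).elim
      · simpa using h
    rw [hV0] at this
    exact this

/-- A locally finite open cover of a normal space with `e-dim ≤ [S^n]` has an open shrinking of
order at most `n + 1`. -/
theorem EDimLE.exists_shrinking_order_le {X : Type u} [TopologicalSpace X] [NormalSpace X]
    {n : ℕ} (hX : EDimLE X (Sph n)) {ι : Type v} {U : ι → Set X} (hU : ∀ i, IsOpen (U i))
    (hfin : LocallyFinite U) (hcov : ⋃ i, U i = univ) :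
    ∃ W : ι → Set X, (∀ i, IsOpen (W i)) ∧ (∀ i, W i ⊆ U i) ∧ ⋃ i, W i = univ ∧
      ∀ T : Finset ι, T.card = n + 2 → ⋂ s ∈ T, W s = ∅ := by
  classical
  let I : Finset ι → Set X := fun T => ⋂ s ∈ T, closure (U s)
  have hI : LocallyFinite I := locallyFinite_biInter_finset hfin.closure
  let P := {p : Set (Finset ι) × (ι → Set X) // (∀ i, IsOpen (p.2 i)) ∧ (∀ i, p.2 i ⊆ U i) ∧
    ⋃ i, p.2 i = univ ∧ ∀ T ∈ p.1, ⋂ s ∈ T, p.2 s = ∅}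
  -- Zorn's lemma on pairs (treated index sets, current cover). Points may be lost only in `I T` for
  -- newly treated `T`; as `I` is locally finite, chains stabilise locally, so their intersections
  -- remain open covers.
  let r : P → P → Prop := fun p q => p.1.1 ⊆ q.1.1 ∧ (∀ i, q.1.2 i ⊆ p.1.2 i) ∧
    ∀ i, p.1.2 i \ q.1.2 i ⊆ ⋃ T ∈ q.1.1 \ p.1.1, I T
  have hrefl (p : P) : r p p := ⟨Subset.rfl, fun _ => Subset.rfl, by simp⟩
  have htrans {a b c : P} (hab : r a b) (hbc : r b c) : r a c := by
    refine ⟨hab.1.trans hbc.1, fun i => (hbc.2.1 i).trans (hab.2.1 i), fun i x hx => ?_⟩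
    by_cases hxb : x ∈ b.1.2 i
    · obtain ⟨T, hT, hxT⟩ := mem_iUnion₂.1 (hbc.2.2 i ⟨hxb, hx.2⟩)
      exact mem_iUnion₂.2 ⟨T, ⟨hT.1, fun h => hT.2 (hab.1 h)⟩, hxT⟩
    · obtain ⟨T, hT, hxT⟩ := mem_iUnion₂.1 (hab.2.2 i ⟨hx.1, hxb⟩)
      exact mem_iUnion₂.2 ⟨T, ⟨hbc.1 hT.1, hT.2⟩, hxT⟩
  have : Std.Refl r := ⟨hrefl⟩
  have : Nonempty P := ⟨⟨(∅, U), hU, fun _ => Subset.rfl, hcov, by simp⟩⟩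
  obtain ⟨m, hm⟩ := exists_maximal_of_nonempty_chains_bounded (r := r) (fun c hc hne => by
    -- near each point, the members of the chain are eventually constant
    have hloc (x : X) : ∃ N ∈ 𝓝 x, ∃ p ∈ c, ∀ q ∈ c, ∀ i, p.1.2 i ∩ N ⊆ q.1.2 i := by
      obtain ⟨N, hN, hNfin⟩ := hI x
      have hdir : DirectedOn (fun a b : P => a.1.1 ⊆ b.1.1) c := fun a ha b hb => by
        rcases hc.total ha hb with h | h
        exacts [⟨b, hb, h.1, Subset.rfl⟩, ⟨a, ha, Subset.rfl, h.1⟩]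
      have hsub : ∃ p ∈ c, {T | (I T ∩ N).Nonempty} ∩ ⋃ q ∈ c, q.1.1 ⊆ p.1.1 := by
        have hf := hNfin.inter_of_left (⋃ q ∈ c, q.1.1)
        obtain ⟨p, hp, hpT⟩ := hdir.exists_mem_subset_of_finset_subset_biUnion hne
          (s := hf.toFinset) (by simp)
        exact ⟨p, hp, by simpa using hpT⟩
      obtain ⟨p, hp, hpT⟩ := hsub
      refine ⟨N, hN, p, hp, fun q hq i y hy => ?_⟩
      rcases hc.total hp hq with h | h
      · by_contra hyq
        obtain ⟨T, hT, hyT⟩ := mem_iUnion₂.1 (h.2.2 i ⟨hy.1, hyq⟩)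
        exact hT.2 (hpT ⟨⟨y, hyT, hy.2⟩, mem_biUnion hq hT.1⟩)
      · exact h.2.1 i hy.1
    have hmem {x : X} {i} {p : P} (hp : p ∈ c) (h : x ∈ ⋂ q ∈ c, q.1.2 i) : x ∈ p.1.2 i :=
      mem_iInter₂.1 h p hp
    refine ⟨⟨(⋃ q ∈ c, q.1.1, fun i => ⋂ q ∈ c, q.1.2 i), fun i => ?_, fun i x hx => ?_, ?_,
      fun T hT => ?_⟩, fun p hp => ⟨subset_biUnion_of_mem (u := fun q : P => q.1.1) hp,
        fun i x hx => hmem hp hx, fun i x hx => ?_⟩⟩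
    · refine isOpen_iff_mem_nhds.2 fun x hx => ?_
      obtain ⟨N, hN, p, hp, hpN⟩ := hloc x
      filter_upwards [hN, (p.2.1 i).mem_nhds (hmem hp hx)] with y hyN hyp
      exact mem_iInter₂.2 fun q hq => hpN q hq i ⟨hyp, hyN⟩
    · obtain ⟨p, hp⟩ := hne
      exact p.2.2.1 i (hmem hp hx)
    · refine eq_univ_of_forall fun x => ?_
      obtain ⟨N, hN, p, hp, hpN⟩ := hloc x
      obtain ⟨i, hi⟩ := mem_iUnion.1 (p.2.2.2.1.symm ▸ mem_univ x : x ∈ ⋃ i, p.1.2 i)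
      exact mem_iUnion.2 ⟨i, mem_iInter₂.2 fun q hq => hpN q hq i ⟨hi, mem_of_mem_nhds hN⟩⟩
    · obtain ⟨p, hp, hpT⟩ := mem_iUnion₂.1 hT
      exact subset_empty_iff.1
        ((iInter₂_mono fun s _ x hx => hmem hp hx).trans (p.2.2.2.2 T hpT).subset)
    · have : ∃ q ∈ c, x ∉ q.1.2 i := by
        by_contra! h
        exact hx.2 (mem_iInter₂.2 h)
      obtain ⟨q, hq, hxq⟩ := this
      rcases hc.total hp hq with h | h
      · obtain ⟨T, hT, hxT⟩ := mem_iUnion₂.1 (h.2.2 i ⟨hx.1, hxq⟩)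
        exact mem_iUnion₂.2 ⟨T, ⟨mem_biUnion hq hT.1, hT.2⟩, hxT⟩
      · exact (hxq (h.2.1 i hx.1)).elim) htrans
  obtain ⟨⟨𝒜, W⟩, hWo, hWU, hWcov, hW⟩ := m
  refine ⟨W, hWo, hWU, hWcov, fun T hT => hW T ?_⟩
  by_contra hT𝒜
  have hIc : IsClosed (I T) := isClosed_biInter fun s _ => isClosed_closure
  obtain ⟨V, hVo, hVW, hWV, hVcov, hV⟩ := hX.exists_shrinking_biInter_eq_empty hWo hWcov hT hIc
    (iInter₂_mono fun s _ => (hWU s).trans subset_closure)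
  have := hm ⟨(insert T 𝒜, V), hVo, fun i => (hVW i).trans (hWU i), hVcov, fun T' hT' => by
    rcases hT' with rfl | hT'
    · exact hV
    · exact subset_empty_iff.1 ((iInter₂_mono fun s _ => hVW s).trans (hW T' hT').subset)⟩
    ⟨subset_insert _ _, hVW, fun i x hx =>
      mem_iUnion₂.2 ⟨T, ⟨mem_insert _ _, hT𝒜⟩, hWV i hx⟩⟩
  exact hT𝒜 (this.1 (mem_insert _ _))

/-- A locally finite closed cover of order at most `n + 1` subordinate to a given open cover. -/
theorem EDimLE.exists_closed_cover_order_le {X : Type u} [TopologicalSpace X] [T2Space X]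
    [ParacompactSpace X] {n : ℕ} (hX : EDimLE X (Sph n)) {ι : Type v} {c : ι → Set X}
    (hc : ∀ i, IsOpen (c i)) (hcov : ⋃ i, c i = univ) :
    ∃ D : ι → Set X, (∀ i, IsClosed (D i)) ∧ LocallyFinite D ∧ (∀ i, D i ⊆ c i) ∧
      ⋃ i, D i = univ ∧ ∀ T : Finset ι, T.card = n + 2 → ⋂ s ∈ T, D s = ∅ := by
  obtain ⟨U, hUo, hUcov, hUf, hUc⟩ := precise_refinement c hc hcov
  obtain ⟨W, hWo, hWU, hWcov, hW⟩ := hX.exists_shrinking_order_le hUo hUf hUcov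
  have hWf : LocallyFinite W := hUf.subset hWU
  obtain ⟨D, hDcov, hDc, hDW⟩ := exists_iUnion_eq_closed_subset hWo hWf.point_finite hWcov
  exact ⟨D, hDc, hWf.subset hDW, fun i => (hDW i).trans ((hWU i).trans (hUc i)), hDcov,
    fun T hT => subset_empty_iff.1 ((iInter₂_mono fun s _ => hDW s).trans (hW T hT).subset)⟩

/-! ### Multiplicity strata of a closed cover -/

/-- The points lying in at least `j` members of the family `D`. -/
def pointsOfOrderGE {X : Type u} {ι : Type v} (D : ι → Set X) (j : ℕ) : Set X :=
  ⋃ T : {T : Finset ι // T.card = j}, ⋂ s ∈ T.1, D s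

theorem isClosed_pointsOfOrderGE {X : Type u} [TopologicalSpace X] {ι : Type v} {D : ι → Set X}
    (hD : LocallyFinite D) (hc : ∀ i, IsClosed (D i)) (j : ℕ) :
    IsClosed (pointsOfOrderGE D j) :=
  ((locallyFinite_biInter_finset hD).comp_injective Subtype.val_injective).isClosed_iUnion
    fun _ => isClosed_biInter fun s _ => hc s

/-- The union of two distinct `j`-sets has more than `j` elements. This makes extensions over
different `j`-fold intersections compatible. -/
theorem biInter_inter_subset_pointsOfOrderGE {X : Type u} {ι : Type v} (D : ι → Set X) {j : ℕ}
    {S T : Finset ι} (hS : S.card = j) (hT : T.card = j) (hST : S ≠ T) :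
    (⋂ s ∈ S, D s) ∩ ⋂ s ∈ T, D s ⊆ pointsOfOrderGE D (j + 1) := by
  classical
  rintro x ⟨hxS, hxT⟩
  obtain ⟨t, htT, htS⟩ : ∃ t ∈ T, t ∉ S := by
    by_contra! h
    exact hST (Finset.eq_of_subset_of_card_le h (by omega)).symm
  refine mem_iUnion.2 ⟨⟨insert t S, by rw [Finset.card_insert_of_notMem htS, hS]⟩,
    mem_iInter₂.2 fun s hs => ?_⟩
  rcases Finset.mem_insert.1 hs with rfl | hs
  exacts [mem_iInter₂.1 hxT _ htT, mem_iInter₂.1 hxS s hs]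

theorem EDimLE.of_isClosed {X : Type u} [TopologicalSpace X] {L : Type w} [TopologicalSpace L]
    (hX : EDimLE X L) {D : Set X} (hD : IsClosed D) : EDimLE D L := by
  intro A hA f
  let e : A ≃ₜ (Subtype.val '' A : Set X) :=
    IsEmbedding.subtypeVal.homeomorphImage A
  obtain ⟨g, hg⟩ := hX _ (hD.isClosedMap_subtype_val A hA) (f.comp ⟨e.symm, e.symm.continuous⟩)
  refine ⟨g.comp ⟨Subtype.val, continuous_subtype_val⟩, fun a => ?_⟩
  have := hg (e a)
  exact this.trans (congrArg f (e.symm_apply_apply a))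

/-! ### Extension by decreasing multiplicity -/

section

variable {X : Type u} [TopologicalSpace X] {Y : Type v} [TopologicalSpace Y]

/-- On sufficiently small closed sets, partial maps with graph in `V` extend to maps with graph
in `U`; smallness is measured by the open neighbourhoods `c x`. -/
def ExtendsOnSmall (c : X → Set X) (V U : Set (X × Y)) : Prop :=
  ∀ D : Set X, IsClosed D → (∃ x, D ⊆ c x) → ∀ B ⊆ D, IsClosed B → ∀ f : X → Y,
    ContinuousOn f B → (∀ x ∈ B, (x, f x) ∈ V) →
      ∃ g : X → Y, ContinuousOn g D ∧ EqOn g f B ∧ ∀ x ∈ D, (x, g x) ∈ U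

/-- Partial maps with graph in `V ⊆ U` extend locally to maps with graph in `U`. -/
def LocallyExtends (V U : Set (X × Y)) : Prop :=
  V ⊆ U ∧ ∃ c : X → Set X, (∀ x, IsOpen (c x)) ∧ (∀ x, x ∈ c x) ∧ ExtendsOnSmall c V U

/-- `V` and `U` are joined by a chain of `m` successive local extension steps. -/
def ExtensionChain : ℕ → Set (X × Y) → Set (X × Y) → Prop
  | 0, V, U => V = U
  | m + 1, V, U => ∃ W, LocallyExtends V W ∧ ExtensionChain m W U

theorem ExtendsOnSmall.exists_extension_pointsOfOrderGE {c : X → Set X} {V U : Set (X × Y)}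
    (h : ExtendsOnSmall c V U) (hVU : V ⊆ U) {ι : Type w} {D : ι → Set X}
    (hDc : ∀ i, IsClosed (D i)) (hDf : LocallyFinite D) (hDs : ∀ i, ∃ x, D i ⊆ c x)
    {A : Set X} (hA : IsClosed A) (j : ℕ) {f : X → Y}
    (hf : ContinuousOn f (A ∪ pointsOfOrderGE D (j + 2)))
    (hfV : ∀ x ∈ A ∪ pointsOfOrderGE D (j + 2), (x, f x) ∈ V) :
    ∃ g : X → Y, ContinuousOn g (A ∪ pointsOfOrderGE D (j + 1)) ∧ EqOn g f A ∧
      ∀ x ∈ A ∪ pointsOfOrderGE D (j + 1), (x, g x) ∈ U := by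
  classical
  set P : Set X := A ∪ pointsOfOrderGE D (j + 2) with hP
  have hPc : IsClosed P := hA.union (isClosed_pointsOfOrderGE hDf hDc _)
  let ℱ := {T : Finset ι // T.card = j + 1}
  let E : ℱ → Set X := fun T => ⋂ s ∈ T.1, D s
  have hEc (T) : IsClosed (E T) := isClosed_biInter fun s _ => hDc s
  have hEf : LocallyFinite E :=
    (locallyFinite_biInter_finset hDf).comp_injective Subtype.val_injective
  have hEs (T) : ∃ x, E T ⊆ c x := by
    obtain ⟨s, hs⟩ := Finset.card_pos.1 (by rw [T.2]; omega : 0 < T.1.card)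
    obtain ⟨x, hx⟩ := hDs s
    exact ⟨x, (biInter_subset_of_mem hs).trans hx⟩
  choose F hFc hFf hFU using fun T => h (E T) (hEc T) (hEs T) (E T ∩ P) inter_subset_left
    ((hEc T).inter hPc) f (hf.mono inter_subset_right) fun x hx => hfV x hx.2
  let g : X → Y := fun x => if x ∈ P then f x else if hx : ∃ T, x ∈ E T then F hx.choose x else f x
  have hgP : EqOn g f P := fun x hx => if_pos hx
  have hgE (T) : EqOn g (F T) (E T) := by
    intro x hx
    by_cases hxP : x ∈ P
    · rw [hgP hxP, hFf T ⟨hx, hxP⟩]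
    · have hex : ∃ T, x ∈ E T := ⟨T, hx⟩
      have : hex.choose = T := by
        by_contra hne
        exact hxP (Or.inr (biInter_inter_subset_pointsOfOrderGE D hex.choose.2 T.2
          (fun h => hne (Subtype.ext h)) ⟨hex.choose_spec, hx⟩))
      simp only [g, if_neg hxP, dif_pos hex, this]
  have hunion : ContinuousOn g (P ∪ ⋃ T, E T) :=
    (hf.congr hgP).union_of_isClosed
      (hEf.continuousOn_iUnion hEc fun T => (hFc T).congr (hgE T)) hPc
      (hEf.isClosed_iUnion hEc)
  refine ⟨g, hunion.mono (union_subset_union_left _ subset_union_left),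
    hgP.mono subset_union_left, ?_⟩
  rintro x (hx | hx)
  · rw [hgP (Or.inl hx)]
    exact hVU (hfV x (Or.inl hx))
  · obtain ⟨T, hT⟩ := mem_iUnion.1 hx
    rw [hgE T hT]
    exact hFU T x hT

theorem ExtensionChain.exists_extension_pointsOfOrderGE {m : ℕ} {V U : Set (X × Y)}
    (h : ExtensionChain m V U) :
    ∃ c : X → Set X, (∀ x, IsOpen (c x)) ∧ (∀ x, x ∈ c x) ∧
      ∀ {ι : Type w} (D : ι → Set X), (∀ i, IsClosed (D i)) → LocallyFinite D →
        (∀ i, ∃ x, D i ⊆ c x) → ∀ A : Set X, IsClosed A → ∀ (j : ℕ) (f : X → Y),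
          ContinuousOn f (A ∪ pointsOfOrderGE D (j + m + 1)) →
          (∀ x ∈ A ∪ pointsOfOrderGE D (j + m + 1), (x, f x) ∈ V) →
          ∃ g : X → Y, ContinuousOn g (A ∪ pointsOfOrderGE D (j + 1)) ∧ EqOn g f A ∧
            ∀ x ∈ A ∪ pointsOfOrderGE D (j + 1), (x, g x) ∈ U := by
  induction m generalizing V with
  | zero =>
    obtain rfl : V = U := h
    exact ⟨fun _ => univ, fun _ => isOpen_univ, fun _ => mem_univ _,
      fun D _ _ _ A _ j f hf hfV => ⟨f, hf, fun _ _ => rfl, hfV⟩⟩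
  | succ m ih =>
    obtain ⟨W, ⟨hVW, c, hco, hc, hcE⟩, hW⟩ := h
    obtain ⟨d, hdo, hd, hdE⟩ := ih hW
    refine ⟨fun x => c x ∩ d x, fun x => (hco x).inter (hdo x), fun x => ⟨hc x, hd x⟩,
      fun D hDc hDf hDs A hA j f hf hfV => ?_⟩
    obtain ⟨g, hg, hgf, hgW⟩ := hcE.exists_extension_pointsOfOrderGE hVW hDc hDf
      (fun i => (hDs i).imp fun x hx => hx.trans inter_subset_left) hA (j + m) hf hfV
    obtain ⟨k, hk, hkg, hkU⟩ := hdE D hDc hDf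
      (fun i => (hDs i).imp fun x hx => hx.trans inter_subset_right) A hA j g hg hgW
    exact ⟨k, hk, hkg.trans hgf, hkU⟩

/-- In a paracompact space with `e-dim ≤ [S^n]`, a chain of `n + 1` local extension steps yields
global extensions. -/
theorem ExtensionChain.exists_extension [T2Space X] [ParacompactSpace X] {n : ℕ}
    (hX : EDimLE X (Sph n)) {V U : Set (X × Y)} (h : ExtensionChain (n + 1) V U) {A : Set X}
    (hA : IsClosed A) {f : X → Y} (hf : ContinuousOn f A) (hfV : ∀ x ∈ A, (x, f x) ∈ V) :
    ∃ g : C(X, Y), EqOn g f A ∧ ∀ x, (x, g x) ∈ U := by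
  obtain ⟨c, hco, hc, hcE⟩ := h.exists_extension_pointsOfOrderGE
  obtain ⟨D, hDc, hDf, hDs, hDcov, hD⟩ := hX.exists_closed_cover_order_le hco
    (eq_univ_of_forall fun x => mem_iUnion.2 ⟨x, hc x⟩)
  have hempty : A ∪ pointsOfOrderGE D (0 + (n + 1) + 1) = A := by
    have : pointsOfOrderGE D (0 + (n + 1) + 1) = ∅ :=
      iUnion_eq_empty.2 fun T => hD T.1 (by rw [T.2]; omega)
    rw [this, union_empty]
  have huniv : A ∪ pointsOfOrderGE D (0 + 1) = univ := by
    refine eq_univ_of_forall fun x => Or.inr ?_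
    obtain ⟨i, hi⟩ := mem_iUnion.1 (hDcov.symm ▸ mem_univ x : x ∈ ⋃ i, D i)
    exact mem_iUnion.2 ⟨⟨{i}, by simp⟩, by simpa using hi⟩
  obtain ⟨g, hg, hgf, hgU⟩ := hcE D hDc hDf (fun i => ⟨i, hDs i⟩) A hA 0 f
    (by rwa [hempty]) (by rwa [hempty])
  rw [huniv] at hg hgU
  exact ⟨⟨g, continuousOn_univ.1 hg⟩, hgf, fun x => hgU x (mem_univ x)⟩

theorem LConnectedPair.exists_extension [T2Space X] [ParacompactSpace X] {L : Type w}
    [TopologicalSpace L] (hX : EDimLE X L) {V U : Set Y} (h : LConnectedPair.{u} L V U)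
    {D B : Set X} (hD : IsClosed D) (hB : IsClosed B) (hBD : B ⊆ D) {f : X → Y}
    (hf : ContinuousOn f B) (hfV : ∀ x ∈ B, f x ∈ V) :
    ∃ g : X → Y, ContinuousOn g D ∧ EqOn g f B ∧ ∀ x ∈ D, g x ∈ U := by
  classical
  have : ParacompactSpace D := hD.isClosedEmbedding_subtypeVal.paracompactSpace
  obtain ⟨g, hgU, hgf⟩ := h.2 D (hX.of_isClosed hD) (Subtype.val ⁻¹' B)
    (hB.preimage continuous_subtype_val)
    ⟨fun x => f x.1.1, hf.comp_continuous
      (continuous_subtype_val.comp continuous_subtype_val) fun x => x.2⟩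
    fun x => hfV _ x.2
  have hgD (x : D) : (if h : (x : X) ∈ D then g ⟨x, h⟩ else f x) = g x := dif_pos x.2
  refine ⟨fun x => if h : x ∈ D then g ⟨x, h⟩ else f x, ?_, fun x hx => ?_, fun x hx => ?_⟩
  · rw [continuousOn_iff_continuous_domRestrict]
    exact g.continuous.congr fun x => (hgD x).symm
  · exact (hgD ⟨x, hBD hx⟩).trans (hgf ⟨⟨x, hBD hx⟩, hx⟩)
  · have := hgU ⟨x, hx⟩
    rwa [← hgD] at this

/-- One step down a filtration. -/
theorem exists_isStableNhdOver_locallyExtends [T2Space X] [ParacompactSpace X] {L : Type w}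
    [TopologicalSpace L] (hX : EDimLE X L) {Φ Ψ : X → Set Y} (hΦ : UpperHemicontinuous Φ)
    (h : ∀ x, UVConnectedPair.{u} L (Φ x) (Ψ x)) {U : Set (X × Y)}
    (hU : IsStableNhdOver Ψ univ U) :
    ∃ V : Set (X × Y), IsStableNhdOver Φ univ V ∧ LocallyExtends V U := by
  choose O M hO hxO hM hΨM hOM using fun x => hU.2 x (mem_univ x)
  choose M' hM' hΦM' hLM using fun x => (h x).2 (M x) (hM x) (hΨM x x (hxO x))
  have hN (x) : ∃ N, IsOpen N ∧ x ∈ N ∧ N ⊆ O x ∧ ∀ x' ∈ N, Φ x' ⊆ M' x := by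
    have h1 := upperHemicontinuousAt_iff.1 (hΦ.upperHemicontinuousAt x) (M' x)
      ((hM' x).mem_nhdsSet.2 (hΦM' x))
    obtain ⟨N, hN, hNo, hxN⟩ := eventually_nhds_iff.1 h1
    exact ⟨N ∩ O x, hNo.inter (hO x), ⟨hxN, hxO x⟩, inter_subset_right,
      fun x' hx' => subset_of_mem_nhdsSet (hN x' hx'.1)⟩
  choose N hNo hxN hNO hΦN using hN
  obtain ⟨N', hN'o, hN'cov, hN'f, hN'N⟩ := precise_refinement N hNo
    (eq_univ_of_forall fun x => mem_iUnion.2 ⟨x, hxN x⟩)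
  obtain ⟨G, hGcov, hGo, hGN⟩ := exists_iUnion_eq_closure_subset hN'o hN'f.point_finite hN'cov
  have hGf : LocallyFinite fun i => closure (G i) := hN'f.subset hGN
  let V : Set (X × Y) := {p | ∀ i, p.1 ∈ closure (G i) → p.2 ∈ M' i}
  choose i hG using fun x => mem_iUnion.1 (hGcov.symm ▸ mem_univ x : x ∈ ⋃ i, G i)
  -- near `x`, the condition defining `V` is implied by the one at `x`
  have hloc (x) : ∃ Q, IsOpen Q ∧ x ∈ Q ∧ (∀ x' ∈ Q, ∀ i, x' ∈ closure (G i) →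
      x ∈ closure (G i)) ∧ ∀ x' ∈ Q, ∀ i, x ∈ closure (G i) → x' ∈ N i := by
    have h1 := hGf.iInter_compl_mem_nhds (fun _ => isClosed_closure) x
    have h2 : (⋂ i ∈ {i | x ∈ closure (G i)}, N i) ∈ 𝓝 x :=
      (Filter.biInter_mem (hGf.point_finite x)).2 fun i hi =>
        (hNo i).mem_nhds (hN'N i (hGN i hi))
    obtain ⟨Q, hQ, hQo, hxQ⟩ := mem_nhds_iff.1 (Filter.inter_mem h1 h2)
    refine ⟨Q, hQo, hxQ, fun x' hx' i hi => ?_, fun x' hx' i hi => mem_iInter₂.1 (hQ hx').2 i hi⟩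
    by_contra hxi
    exact mem_iInter₂.1 (hQ hx').1 i hxi hi
  have hMx (x) : IsOpen (⋂ i ∈ {i | x ∈ closure (G i)}, M' i) :=
    (hGf.point_finite x).isOpen_biInter fun i _ => hM' i
  have hVo : IsOpen V := by
    refine isOpen_iff_mem_nhds.2 fun p hp => ?_
    obtain ⟨Q, hQo, hxQ, hQ, -⟩ := hloc p.1
    filter_upwards [(hQo.prod (hMx p.1)).mem_nhds ⟨hxQ, mem_iInter₂.2 fun i hi => hp i hi⟩]
      with q hq i hi
    exact mem_iInter₂.1 hq.2 i (hQ _ hq.1 i hi)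
  refine ⟨V, ⟨hVo, fun x _ => ?_⟩, ?_, fun x => G (i x), fun x => hGo _, hG, ?_⟩
  · obtain ⟨Q, hQo, hxQ, hQ, hQN⟩ := hloc x
    refine ⟨Q, ⋂ i ∈ {i | x ∈ closure (G i)}, M' i, hQo, hxQ, hMx x, fun x' hx' => ?_, ?_⟩
    · exact subset_iInter₂ fun i hi => hΦN i x' (hQN x' hx' i hi)
    · exact fun p hp i hi => mem_iInter₂.1 hp.2 i (hQ _ hp.1 i hi)
  · intro p hp
    have hi := subset_closure (hG p.1)
    exact hOM _ ⟨hNO _ (hN'N _ (hGN _ hi)), (hLM _).1 (hp _ hi)⟩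
  · rintro D hD ⟨x, hDx⟩ B hBD hB f hf hfV
    have hDG : D ⊆ closure (G (i x)) := hDx.trans subset_closure
    obtain ⟨g, hg, hgf, hgM⟩ := (hLM (i x)).exists_extension hX hD hB hBD hf
      fun z hz => hfV z hz _ (hDG (hBD hz))
    exact ⟨g, hg, hgf, fun z hz => hOM _ ⟨hNO _ (hN'N _ (hGN _ (hDG hz))), hgM z hz⟩⟩

theorem exists_extensionChain [T2Space X] [ParacompactSpace X] {L : Type w}
    [TopologicalSpace L] (hX : EDimLE X L) {m : ℕ} (Φ : Fin (m + 1) → X → Set Y)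
    (husc : ∀ k, UpperHemicontinuous (Φ k))
    (h : ∀ (i : Fin m) (x : X), UVConnectedPair.{u} L (Φ i.castSucc x) (Φ i.succ x))
    {U : Set (X × Y)} (hU : IsStableNhdOver (Φ (Fin.last m)) univ U) :
    ∃ V : Set (X × Y), IsStableNhdOver (Φ 0) univ V ∧ ExtensionChain m V U := by
  induction m with
  | zero => exact ⟨U, hU, rfl⟩
  | succ m ih =>
    obtain ⟨W, hW, hWU⟩ := ih (fun k => Φ k.succ) (fun k => husc _) (fun i x => h i.succ x) hU
    obtain ⟨V, hV, hVW⟩ := exists_isStableNhdOver_locallyExtends hX (husc 0) (h 0) hW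
    exact ⟨V, hV, W, hVW, hWU⟩

/-- Small sets admit constant sections with graph in a stable neighbourhood. -/
theorem IsStableNhdOver.locallyExtends_empty {Φ : X → Set Y} (hne : ∀ x, (Φ x).Nonempty)
    {U : Set (X × Y)} (hU : IsStableNhdOver Φ univ U) : LocallyExtends ∅ U := by
  choose O M hO hxO hM hΦM hOM using fun x => hU.2 x (mem_univ x)
  refine ⟨empty_subset _, O, hO, hxO, fun D _ ⟨x, hDx⟩ B _ _ f _ hfB => ?_⟩
  obtain ⟨y, hy⟩ := hne x
  exact ⟨fun _ => y, continuousOn_const, fun z hz => (hfB z hz).elim,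
    fun z hz => hOM x ⟨hDx hz, hΦM x x (hxO x) hy⟩⟩

theorem IsStableNhdOver.of_subset {F Φ : X → Set Y} (h : ∀ x, Φ x ⊆ F x) {A B : Set X}
    (hBA : B ⊆ A) {U : Set (X × Y)} (hU : IsStableNhdOver F A U) : IsStableNhdOver Φ B U := by
  refine ⟨hU.1, fun x hx => ?_⟩
  obtain ⟨O, M, hO, hxO, hM, hFM, hOM⟩ := hU.2 x (hBA hx)
  exact ⟨O, M, hO, hxO, hM, fun x' hx' => (h x').trans (hFM x' hx'), hOM⟩

end

end ExtDim

theorem mainTheorem2 {L : Type w} [TopologicalSpace L] [T2Space L]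
    [Topology.CWComplex (Set.univ : Set L)] (n : ℕ)
    (hL : ExtDim.ExtTypeLE.{u, w, 0} L (ExtDim.Sph n))
    {X : Type u} [TopologicalSpace X] [T2Space X] [ParacompactSpace X]
    (hX : ExtDim.EDimLE X L)
    {Y : Type v} [TopologicalSpace Y] (F : X → Set Y) :
    ((∃ Φ : Fin (n + 1) → X → Set Y, ExtDim.IsUVFiltration L n F Φ) →
      ∀ U : Set (X × Y), ExtDim.IsStableNhdOver F Set.univ U →
        ∃ f : C(X, Y), ∀ x, (x, f x) ∈ U) ∧
    (∀ A : Set X, IsClosed A →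
      ∀ Φ : Fin (n + 2) → X → Set Y, ExtDim.IsUVFiltration L (n + 1) F Φ →
        ∀ U : Set (X × Y), ExtDim.IsStableNhdOver F Set.univ U →
          ∃ V : Set (X × Y), ExtDim.IsStableNhdOver (Φ 0) A V ∧
            ∀ g : C(A, Y), (∀ a : A, ((a : X), g a) ∈ V) →
              ∃ f : C(X, Y), (∀ a : A, f a = g a) ∧ ∀ x, (x, f x) ∈ U) := by
  classical
  have hXn : ExtDim.EDimLE X (ExtDim.Sph n) := hL X hX
  refine ⟨fun ⟨Φ, hΦ⟩ U hU => ?_, fun A hA Φ hΦ U hU => ?_⟩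
  · obtain ⟨V, hV, hVU⟩ := ExtDim.exists_extensionChain hX Φ hΦ.usc hΦ.uvConnected
      (hU.of_subset (hΦ.subset _) Subset.rfl)
    have hchain : ExtDim.ExtensionChain (n + 1) ∅ U :=
      ⟨V, hV.locallyExtends_empty (hΦ.nonempty 0), hVU⟩
    obtain ⟨f, -, hf⟩ := hchain.exists_extension hXn isClosed_empty
      (f := fun x => (hΦ.nonempty 0 x).some) (continuousOn_empty _) (by simp)
    exact ⟨f, hf⟩
  · obtain ⟨V, hV, hVU⟩ := ExtDim.exists_extensionChain hX Φ hΦ.usc hΦ.uvConnected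
      (hU.of_subset (hΦ.subset _) Subset.rfl)
    refine ⟨V, hV.of_subset (fun _ => Subset.rfl) (subset_univ A), fun g hg => ?_⟩
    have hfg (a : A) : (if h : (a : X) ∈ A then g ⟨a, h⟩ else (hΦ.nonempty 0 a).some) = g a :=
      dif_pos a.2
    obtain ⟨f, hfA, hf⟩ := hVU.exists_extension hXn hA
      (f := fun x => if h : x ∈ A then g ⟨x, h⟩ else (hΦ.nonempty 0 x).some)
      (by
        rw [continuousOn_iff_continuous_domRestrict]
        exact g.continuous.congr fun x => (hfg x).symm)
      (fun x hx => by simpa only [hfg ⟨x, hx⟩, dif_pos hx] using hg ⟨x, hx⟩)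
    exact ⟨f, fun a => (hfA a.2).trans (hfg a), hf⟩
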